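/- Let $n\ge 2$, let $F_q$ be a finite field of characteristic $p$, let $G=\mathrm{GL}_n(q)=\mathrm{GL}_n(F_q)$, and let $B$ be the subgroup of upper triangular matrices in $G$. View the symmetric group $S_n$ as the subgroup of permutation matrices of $G$. Let $\ell$ be a prime different from $p$, and let $R$ be a local principal ideal domain of characteristic $0$ with maximal ideal $\ell R$ that contains a primitive $p$-th root of unity. Put $K=R/\ell R$. In the group algebra $RG$ let $$e=\Big(\sum_{\sigma\in S_n}\mathrm{sign}(\sigma)\,\sigma\Big)\sum_{b\in B}b,$$ let $I=RGe$ be the left ideal generated by $e$ (the Steinberg lattice), and let $\overline{I}=I/\ell I$, regarded as a $KG$-module. Then $\overline{I}$ is self-dual (that is, isomorphic as a $KG$-module to its dual $\mathrm{Hom}_K(\overline{I},K)$ with the contragredient action of $G$) if and only if $\overline{I}$ is irreducible. -/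

import Mathlib

open scoped MonoidAlgebra

noncomputable section

namespace SteinbergLattice

/-- The symmetric group as a subgroup of `GL_n(F)`: `σ` goes to the permutation matrix whose
`(i, j)` entry is `1` if `i = σ j` and `0` otherwise. -/
def permGL (n : ℕ) (F : Type*) [Field F] : Equiv.Perm (Fin n) →* GL (Fin n) F :=
  (Matrix.permMatrixHom (n := Fin n) (R := F)).toHomUnits

theorem permGL_apply (n : ℕ) (F : Type*) [Field F] (σ : Equiv.Perm (Fin n)) (i j : Fin n) :
    (permGL n F σ : Matrix (Fin n) (Fin n) F) i j = if i = σ j then 1 else 0 := by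
  simp [permGL, Matrix.permMatrixHom, PEquiv.toMatrix_apply, Equiv.toPEquiv_apply,
    Equiv.Perm.inv_def]
  simp only [Equiv.eq_symm_apply, eq_comm]

open Classical in
/-- The Borel subgroup `B` of invertible upper triangular matrices, as a finite set. -/
def borel (n : ℕ) (F : Type*) [Field F] [Fintype F] : Finset (GL (Fin n) F) :=
  Finset.univ.filter fun g => ∀ i j : Fin n, j < i → (g : Matrix (Fin n) (Fin n) F) i j = 0

/-- Steinberg's element `e = (∑ σ, sign σ • σ) * (∑ b ∈ B, b)` of the group algebra `R[G]`,
`G = GL_n(F)`. -/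
def steinbergElement (n : ℕ) (F R : Type*) [Field F] [Fintype F] [CommRing R] :
    R[GL (Fin n) F] :=
  (∑ σ : Equiv.Perm (Fin n),
      MonoidAlgebra.single (permGL n F σ) (((Equiv.Perm.sign σ : ℤˣ) : ℤ) : R)) *
    ∑ b ∈ borel n F, MonoidAlgebra.single b (1 : R)

/-- The Steinberg lattice: the left ideal `I = R[G] e` of `R[G]`. -/
def lattice (n : ℕ) (F R : Type*) [Field F] [Fintype F] [CommRing R] :
    Submodule R[GL (Fin n) F] R[GL (Fin n) F] :=
  Submodule.span R[GL (Fin n) F] {steinbergElement n F R}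

/-- The action of `G` on the Steinberg lattice by left multiplication. -/
def latticeRep (n : ℕ) (F R : Type*) [Field F] [Fintype F] [CommRing R] :
    Representation R (GL (Fin n) F) (lattice n F R) :=
  Representation.ofModule' (lattice n F R)

theorem coe_latticeRep_apply (n : ℕ) (F R : Type*) [Field F] [Fintype F] [CommRing R]
    (g : GL (Fin n) F) (x : lattice n F R) :
    (latticeRep n F R g x : R[GL (Fin n) F]) =
      MonoidAlgebra.single g (1 : R) * (x : R[GL (Fin n) F]) := by
  simp [latticeRep, Representation.ofModule', MonoidAlgebra.lift]

section Reduction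

variable (R : Type*) [CommRing R] [IsLocalRing R] (V : Type*) [AddCommGroup V] [Module R V]

/-- The quotient `V / 𝔪V`, where `𝔪` is the maximal ideal of the local ring `R`.
If `𝔪 = ℓR`, this is `V / ℓV`. -/
def ModReduction : Type _ := V ⧸ (IsLocalRing.maximalIdeal R • (⊤ : Submodule R V))

instance : AddCommGroup (ModReduction R V) :=
  inferInstanceAs (AddCommGroup (V ⧸ (IsLocalRing.maximalIdeal R • (⊤ : Submodule R V))))

instance : Module R (ModReduction R V) :=
  inferInstanceAs (Module R (V ⧸ (IsLocalRing.maximalIdeal R • (⊤ : Submodule R V))))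

/-- The vector space structure of `V / 𝔪V` over the residue field `K = R / 𝔪`. -/
instance : Module (IsLocalRing.ResidueField R) (ModReduction R V) :=
  inferInstanceAs (Module (R ⧸ IsLocalRing.maximalIdeal R)
    (V ⧸ (IsLocalRing.maximalIdeal R • (⊤ : Submodule R V))))

/-- The canonical projection `V → V / 𝔪V`. -/
def ModReduction.mk : V →ₗ[R] ModReduction R V :=
  (IsLocalRing.maximalIdeal R • (⊤ : Submodule R V)).mkQ

theorem ModReduction.mk_surjective : Function.Surjective (ModReduction.mk R V) :=
  Submodule.mkQ_surjective _

theorem ModReduction.residue_smul_mk (r : R) (v : V) :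
    IsLocalRing.residue R r • ModReduction.mk R V v = ModReduction.mk R V (r • v) := rfl

theorem ModReduction.mk_eq_zero_iff (a : R) (ha : IsLocalRing.maximalIdeal R = Ideal.span {a})
    (v : V) : ModReduction.mk R V v = 0 ↔ ∃ w : V, v = a • w := by
  refine (Submodule.Quotient.mk_eq_zero _).trans ?_
  rw [ha, Submodule.ideal_span_singleton_smul]
  simp [Submodule.mem_smul_pointwise_iff_exists, eq_comm]

variable {R V} {G : Type*} [Monoid G]

/-- An `R`-linear endomorphism of `V` induces a `K`-linear one of `V / 𝔪V`. -/
def reductionMap (f : V →ₗ[R] V) :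
    ModReduction R V →ₗ[IsLocalRing.ResidueField R] ModReduction R V where
  toFun := Submodule.mapQ (IsLocalRing.maximalIdeal R • (⊤ : Submodule R V))
    (IsLocalRing.maximalIdeal R • (⊤ : Submodule R V)) f
    (Submodule.smul_top_le_comap_smul_top _ f)
  map_add' x y := map_add _ x y
  map_smul' r x := by
    obtain ⟨r, rfl⟩ := IsLocalRing.residue_surjective r
    exact LinearMap.map_smul
      (Submodule.mapQ (IsLocalRing.maximalIdeal R • (⊤ : Submodule R V))
        (IsLocalRing.maximalIdeal R • (⊤ : Submodule R V)) f
        (Submodule.smul_top_le_comap_smul_top _ f)) r x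

theorem reductionMap_mk (f : V →ₗ[R] V) (v : V) :
    reductionMap f (ModReduction.mk R V v) = ModReduction.mk R V (f v) := rfl

/-- The representation over the residue field `K = R / 𝔪` induced on `V / 𝔪V` by an
`R`-linear representation on `V`. -/
def reductionRep (ρ : Representation R G V) :
    Representation (IsLocalRing.ResidueField R) G (ModReduction R V) where
  toFun g := reductionMap (ρ g)
  map_one' := by
    ext x
    obtain ⟨v, rfl⟩ := ModReduction.mk_surjective R V x
    simp [reductionMap_mk]
  map_mul' g h := by
    ext x
    obtain ⟨v, rfl⟩ := ModReduction.mk_surjective R V x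
    simp [reductionMap_mk]

end Reduction

/-- The reduction of the Steinberg lattice `I` modulo the maximal ideal `𝔪` of `R`: the natural
action of `G` on `I / 𝔪I`, linear over `K = R / 𝔪`. -/
def reducedRep (n : ℕ) (F R : Type*) [Field F] [Fintype F] [CommRing R] [IsLocalRing R] :
    Representation (IsLocalRing.ResidueField R) (GL (Fin n) F)
      (ModReduction R (lattice n F R)) :=
  reductionRep (latticeRep n F R)

/-- A representation is self-dual if it is isomorphic to its dual (contragredient). -/
def IsSelfDual {K G V : Type*} [Field K] [Group G] [AddCommGroup V] [Module K V]
    (ρ : Representation K G V) : Prop :=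
  Nonempty (ρ.Equiv ρ.dual)

end SteinbergLattice

end

/-! Write `U` for the upper unitriangular group. The elements `u e` with `u ∈ U` form an `R`-basis
of `I`. They span because of the relation `s x(a) e = x(a⁻¹) e - e` for a transposition `s` and a
transvection `x(a)`, `a ≠ 0` (`swap_mul_transvectionGL_mul_steinbergElement`). They are independent
by `coeff_unipotent_mul_steinbergElement`, whose coefficients `±1` stay units modulo `ℓ`. Hence the
reduction of `I` embeds in `K[G]`, with image in the lattice over `K` and containing `e`
(`reductionEmbedding_injective`).

Put `y = ∑ u e` over `u ∈ U`. Since `U` is a `p`-group and `ℓ ≠ p`, its order is invertible in `K`.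
The trace over `U` maps everything into the line `K y`, and each nonzero vector has a translate of
nonzero trace, so every nonzero submodule contains `y`.

If `φ` is an isomorphism onto the dual, then `φ(y)(y) ≠ 0`, because `φ(y)` is `U`-invariant and the
vectors `u e` span. For a submodule `W` that is neither zero nor everything, both `W` and `φ⁻¹(W^⊥)`
are nonzero, so both contain `y` and `φ(y)(y) = 0`, a contradiction.

Conversely, the invariant form on functions on `G / B` restricts to a form on the module that takes
the value `1` (`flagForm_upperOnesGL`). If the module is irreducible, the resulting map to the dual
is injective, hence an isomorphism. -/

open scoped MonoidAlgebra

noncomputable section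

namespace SteinbergLattice

/-! ### Borel and unitriangular subgroups, permutation matrices, transvections. -/

section Groups

variable {n : ℕ} {F : Type*} [Field F]

/-- The Borel subgroup of invertible upper triangular matrices. -/
def borelSubgroup (n : ℕ) (F : Type*) [Field F] : Subgroup (GL (Fin n) F) where
  carrier := {g | (g : Matrix (Fin n) (Fin n) F).BlockTriangular id}
  mul_mem' {a b} ha hb := by
    simpa using Matrix.BlockTriangular.mul ha hb
  one_mem' := by simpa using Matrix.blockTriangular_one
  inv_mem' {a} ha := by
    have : Invertible (a : Matrix (Fin n) (Fin n) F) := a.invertible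
    simpa using Matrix.blockTriangular_inv_of_blockTriangular ha

theorem mem_borelSubgroup {g : GL (Fin n) F} :
    g ∈ borelSubgroup n F ↔ ∀ i j : Fin n, j < i → (g : Matrix (Fin n) (Fin n) F) i j = 0 :=
  Iff.rfl

theorem mul_apply_diag {A B : Matrix (Fin n) (Fin n) F} (hA : A.BlockTriangular id)
    (hB : B.BlockTriangular id) (i : Fin n) : (A * B) i i = A i i * B i i := by
  rw [Matrix.mul_apply]
  refine Finset.sum_eq_single i (fun k _ hk => ?_) (by simp)
  rcases lt_or_gt_of_ne hk with h | h
  · rw [hA h, zero_mul]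
  · rw [hB h, mul_zero]

theorem diag_mul_inv_diag {g : GL (Fin n) F} (hg : g ∈ borelSubgroup n F) (i : Fin n) :
    (g : Matrix (Fin n) (Fin n) F) i i * (g⁻¹ : GL (Fin n) F).1 i i = 1 := by
  have h := mul_apply_diag hg ((borelSubgroup n F).inv_mem hg) i
  rw [← Units.val_mul, mul_inv_cancel] at h
  simpa using h.symm

theorem diag_ne_zero {g : GL (Fin n) F} (hg : g ∈ borelSubgroup n F) (i : Fin n) :
    (g : Matrix (Fin n) (Fin n) F) i i ≠ 0 :=
  left_ne_zero_of_mul_eq_one (diag_mul_inv_diag hg i)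

/-- The subgroup of upper unitriangular matrices. -/
def unipotentSubgroup (n : ℕ) (F : Type*) [Field F] : Subgroup (GL (Fin n) F) where
  carrier := {g | g ∈ borelSubgroup n F ∧ ∀ i, (g : Matrix (Fin n) (Fin n) F) i i = 1}
  mul_mem' {a b} ha hb := by
    refine ⟨(borelSubgroup n F).mul_mem ha.1 hb.1, fun i => ?_⟩
    rw [Units.val_mul, mul_apply_diag ha.1 hb.1, ha.2, hb.2, one_mul]
  one_mem' := ⟨(borelSubgroup n F).one_mem, by simp⟩
  inv_mem' {a} ha := by
    refine ⟨(borelSubgroup n F).inv_mem ha.1, fun i => ?_⟩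
    simpa [ha.2] using diag_mul_inv_diag ha.1 i

theorem permGL_inv_mul_mul_permGL_apply (σ τ : Equiv.Perm (Fin n)) (g : GL (Fin n) F)
    (i j : Fin n) :
    ((permGL n F σ)⁻¹ * g * permGL n F τ : GL (Fin n) F).1 i j = g.1 (σ i) (τ j) := by
  rw [← map_inv, Units.val_mul, Units.val_mul, Matrix.mul_apply]
  simp [permGL_apply, Matrix.mul_apply, Equiv.eq_symm_apply,
    Equiv.Perm.inv_def]

/-- Both sides have the same sum over all `i`. This is how nonvanishing diagonal entries of a
triangular matrix determine permutations below. -/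
theorem perm_eq_of_forall_le {σ τ : Equiv.Perm (Fin n)} (h : ∀ i, σ i ≤ τ i) : σ = τ := by
  have hsum : ∑ i, (σ i : ℕ) = ∑ i, (τ i : ℕ) :=
    (Equiv.sum_comp σ Fin.val).trans (Equiv.sum_comp τ Fin.val).symm
  ext i
  exact (Finset.sum_eq_sum_iff_of_le (f := fun i => (σ i : ℕ)) (g := fun i => (τ i : ℕ))
    fun i _ => h i).1 hsum i (Finset.mem_univ i)

theorem exists_unipotent_mul_diagonal {b : GL (Fin n) F} (hb : b ∈ borelSubgroup n F) :
    ∃ u ∈ unipotentSubgroup n F, ∃ t : GL (Fin n) F, t.1.IsDiag ∧ b = u * t := by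
  have hdet : (Matrix.diagonal fun i => b.1 i i).det ≠ 0 := by
    rw [Matrix.det_diagonal]
    exact Finset.prod_ne_zero_iff.2 fun i _ => diag_ne_zero hb i
  set t : GL (Fin n) F := Matrix.GeneralLinearGroup.mkOfDetNeZero _ hdet with ht
  have ht' : t.1 = Matrix.diagonal fun i => b.1 i i := rfl
  have htB : t ∈ borelSubgroup n F := by
    intro i j hij
    have hij : j < i := hij
    exact Matrix.diagonal_apply_ne _ hij.ne'
  refine ⟨b * t⁻¹, ⟨(borelSubgroup n F).mul_mem hb ((borelSubgroup n F).inv_mem htB),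
    fun i => ?_⟩, t, ?_, by simp⟩
  · rw [Units.val_mul, mul_apply_diag hb ((borelSubgroup n F).inv_mem htB)]
    have := diag_mul_inv_diag htB i
    rwa [ht', Matrix.diagonal_apply_eq] at this
  · rw [ht']; exact Matrix.isDiag_diagonal _

/-- With `u = 1 + N` and `N ^ n = 0` by Cayley–Hamilton, Frobenius gives `u ^ p ^ n = 1 + N ^ p ^ n
= 1`, as `n ≤ p ^ n`. -/
theorem isPGroup_unipotentSubgroup (p : ℕ) (hp : p.Prime) [CharP F p] :
    IsPGroup p (unipotentSubgroup n F) := by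
  rintro ⟨u, hu⟩
  refine ⟨n, Subtype.ext (Units.ext ?_)⟩
  have := Fact.mk hp
  rcases Nat.eq_zero_or_pos n with rfl | hn
  · exact Matrix.ext fun i => i.elim0
  have : Nonempty (Fin n) := ⟨⟨0, hn⟩⟩
  set N : Matrix (Fin n) (Fin n) F := u.1 - 1 with hN
  have hNu : u.1 = 1 + N := by rw [hN]; abel
  have hNn : N ^ n = 0 := by
    have htri : N.BlockTriangular id := hu.1.sub Matrix.blockTriangular_one
    have hc := Matrix.charpoly_of_isUpperTriangular N htri
    have hch := Matrix.aeval_self_charpoly N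
    rw [hc] at hch
    simpa [hN, hu.2] using hch
  have hle : n ≤ p ^ n := (Nat.lt_pow_self hp.one_lt).le
  have h0 : N ^ p ^ n = 0 := pow_eq_zero_of_le hle hNn
  simp only [SubmonoidClass.mk_pow, Units.val_pow_eq_pow_val, OneMemClass.coe_one, Units.val_one]
  rw [hNu, add_pow_expChar_pow_of_commute p n (Commute.one_left N), h0, one_pow, add_zero]

/-- The elementary matrix `1 + a E_ij` as an element of `GL_n`. -/
def transvectionGL {i j : Fin n} (hij : i ≠ j) (a : F) : GL (Fin n) F :=
  Matrix.GeneralLinearGroup.mkOfDetNeZero (Matrix.transvection i j a)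
    (by rw [Matrix.det_transvection_of_ne _ _ hij]; exact one_ne_zero)

theorem coe_transvectionGL {i j : Fin n} (hij : i ≠ j) (a : F) :
    (transvectionGL hij a).1 = Matrix.transvection i j a := rfl

theorem transvectionGL_apply {i j : Fin n} (hij : i ≠ j) (a : F) (k l : Fin n) :
    (transvectionGL hij a).1 k l = (if k = l then 1 else 0) + if i = k ∧ j = l then a else 0 := by
  simp [coe_transvectionGL, Matrix.transvection, Matrix.single_apply, Matrix.one_apply]

theorem transvectionGL_zero {i j : Fin n} (hij : i ≠ j) : transvectionGL hij (0 : F) = 1 :=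
  Units.ext (by simp [coe_transvectionGL])

theorem transvectionGL_mul {i j : Fin n} (hij : i ≠ j) (a b : F) :
    transvectionGL hij a * transvectionGL hij b = transvectionGL hij (a + b) :=
  Units.ext (by simp [coe_transvectionGL, Matrix.transvection_mul_transvection_same _ _ hij])

theorem transvectionGL_inv {i j : Fin n} (hij : i ≠ j) (a : F) :
    (transvectionGL hij a)⁻¹ = transvectionGL hij (-a) :=
  inv_eq_of_mul_eq_one_right (by rw [transvectionGL_mul, add_neg_cancel, transvectionGL_zero])

theorem transvectionGL_mem_unipotentSubgroup {i j : Fin n} (hij : i < j) (a : F) :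
    transvectionGL hij.ne a ∈ unipotentSubgroup n F := by
  refine ⟨fun k l hkl => ?_, fun k => ?_⟩
  · have hkl : l < k := hkl
    rw [transvectionGL_apply, if_neg hkl.ne', if_neg, add_zero]
    rintro ⟨rfl, rfl⟩
    exact absurd hij hkl.asymm
  · rw [transvectionGL_apply, if_pos rfl, if_neg, add_zero]
    rintro ⟨rfl, rfl⟩
    exact hij.ne rfl

theorem permGL_inv_mul_transvectionGL_mul_permGL (σ : Equiv.Perm (Fin n)) {i j : Fin n}
    (hij : i ≠ j) (a : F) :
    (permGL n F σ)⁻¹ * transvectionGL (σ.injective.ne hij) a * permGL n F σ =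
      transvectionGL hij a := by
  ext k l
  rw [permGL_inv_mul_mul_permGL_apply, transvectionGL_apply, transvectionGL_apply]
  simp

end Groups

/-! ### Relations satisfied by the Steinberg element. -/

section GroupAlgebra

open MonoidAlgebra

variable {n : ℕ} {F : Type*} [Field F] [Fintype F] {R : Type*} [CommRing R]

theorem mem_borel {g : GL (Fin n) F} : g ∈ borel n F ↔ g ∈ borelSubgroup n F := by
  simp [borel, mem_borelSubgroup]

variable (R) in
/-- The sum of the elements of the coset `gB` in the group algebra. -/
def cosetSum (g : GL (Fin n) F) : R[GL (Fin n) F] :=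
  single g (1 : R) * ∑ b ∈ borel n F, single b (1 : R)

theorem single_mul_cosetSum (g h : GL (Fin n) F) (r : R) :
    single g r * cosetSum R h = r • cosetSum R (g * h) := by
  rw [cosetSum, cosetSum, ← mul_assoc, single_mul_single, mul_one, ← smul_mul_assoc, smul_single,
    smul_eq_mul, mul_one]

theorem cosetSum_mul_of_mem (g : GL (Fin n) F) {b : GL (Fin n) F} (hb : b ∈ borelSubgroup n F) :
    cosetSum R (g * b) = cosetSum R g := by
  rw [cosetSum, cosetSum, ← mul_one (1 : R), ← single_mul_single, mul_assoc, mul_one]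
  congr 1
  rw [Finset.mul_sum]
  refine Finset.sum_equiv (Equiv.mulLeft b) (fun c => ?_) fun c _ => ?_
  · rw [mem_borel, mem_borel, Equiv.coe_mulLeft, Subgroup.mul_mem_cancel_left _ hb]
  · simp

theorem cosetSum_eq {g h : GL (Fin n) F} (hgh : g⁻¹ * h ∈ borelSubgroup n F) :
    cosetSum R h = cosetSum R g := by
  simpa using cosetSum_mul_of_mem (R := R) g hgh

open Classical in
theorem coeff_cosetSum (g h : GL (Fin n) F) :
    (cosetSum R g).coeff h = if g⁻¹ * h ∈ borelSubgroup n F then 1 else 0 := by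
  rw [cosetSum, coeff_single_mul_apply, one_mul, coeff_sum, Finsupp.finsetSum_apply]
  simp [Finsupp.single_apply, mem_borel]

theorem steinbergElement_eq_sum :
    steinbergElement n F R =
      ∑ σ : Equiv.Perm (Fin n),
        (((Equiv.Perm.sign σ : ℤˣ) : ℤ) : R) • cosetSum R (permGL n F σ) := by
  rw [steinbergElement, Finset.sum_mul]
  refine Finset.sum_congr rfl fun σ _ => ?_
  rw [cosetSum, ← smul_mul_assoc, smul_single, smul_eq_mul, mul_one]

theorem single_mul_steinbergElement (g : GL (Fin n) F) :
    single g (1 : R) * steinbergElement n F R =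
      ∑ σ : Equiv.Perm (Fin n),
        (((Equiv.Perm.sign σ : ℤˣ) : ℤ) : R) • cosetSum R (g * permGL n F σ) := by
  rw [steinbergElement_eq_sum, Finset.mul_sum]
  refine Finset.sum_congr rfl fun σ _ => ?_
  rw [mul_smul_comm, single_mul_cosetSum, one_smul]

omit [Fintype F] in
theorem single_mul_single_mul (g h : GL (Fin n) F) (x : R[GL (Fin n) F]) :
    single g (1 : R) * (single h (1 : R) * x) = single (g * h) (1 : R) * x := by
  rw [← mul_assoc, single_mul_single, mul_one]

theorem permGL_mul_steinbergElement (τ : Equiv.Perm (Fin n)) :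
    single (permGL n F τ) (1 : R) * steinbergElement n F R =
      (((Equiv.Perm.sign τ : ℤˣ) : ℤ) : R) • steinbergElement n F R := by
  rw [single_mul_steinbergElement, steinbergElement_eq_sum, Finset.smul_sum]
  refine Fintype.sum_equiv (Equiv.mulLeft τ) _ _ fun σ => ?_
  rw [Equiv.coe_mulLeft, smul_smul, Equiv.Perm.sign_mul, ← Int.cast_mul,
    ← Units.val_mul, ← mul_assoc, Int.units_mul_self, one_mul]
  simp only [map_mul]

theorem diag_mul_steinbergElement {t : GL (Fin n) F} (ht : t.1.IsDiag) :
    single t (1 : R) * steinbergElement n F R = steinbergElement n F R := by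
  rw [single_mul_steinbergElement, steinbergElement_eq_sum]
  refine Finset.sum_congr rfl fun σ _ => ?_
  congr 1
  refine cosetSum_eq fun i j hij => ?_
  have hij : j < i := hij
  rw [← mul_assoc, permGL_inv_mul_mul_permGL_apply]
  exact ht (σ.injective.ne hij.ne')

theorem borel_mul_steinbergElement {b : GL (Fin n) F} (hb : b ∈ borelSubgroup n F) :
    ∃ u ∈ unipotentSubgroup n F,
      single b (1 : R) * steinbergElement n F R = single u (1 : R) * steinbergElement n F R := by
  obtain ⟨u, hu, t, ht, rfl⟩ := exists_unipotent_mul_diagonal hb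
  exact ⟨u, hu, by rw [← single_mul_single_mul, diag_mul_steinbergElement ht]⟩

/-- Conjugation by `σ⁻¹` moves the root `(i, j)` to `(σ⁻¹ i, σ⁻¹ j)`, which is positive by `hσ`; so
the transvection is absorbed by `B`. -/
theorem transvectionGL_mul_cosetSum {i j : Fin n} (hij : i ≠ j) (a : F)
    (σ : Equiv.Perm (Fin n)) (hσ : σ⁻¹ i < σ⁻¹ j) (g : GL (Fin n) F) :
    cosetSum R (g * transvectionGL hij a * permGL n F σ) = cosetSum R (g * permGL n F σ) := by
  refine cosetSum_eq fun k l hkl => ?_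
  have hkl : l < k := hkl
  have : (g * permGL n F σ)⁻¹ * (g * transvectionGL hij a * permGL n F σ) =
    (permGL n F σ)⁻¹ * transvectionGL hij a * permGL n F σ := by group
  rw [this, permGL_inv_mul_mul_permGL_apply, transvectionGL_apply,
    if_neg (σ.injective.ne hkl.ne'), if_neg, add_zero]
  rintro ⟨rfl, rfl⟩
  simp only [Equiv.Perm.inv_def, Equiv.symm_apply_apply] at hσ
  exact absurd hσ hkl.asymm

omit [Fintype F] in
-- In rows and columns `i, j` the product is `[[a, 1], [0, -a⁻¹]]`, and it is the identity
-- elsewhere.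
theorem transvectionGL_mul_transvectionGL_mul_swap_apply {i j : Fin n} (hij : i ≠ j) {a : F}
    (ha : a ≠ 0) {k l : Fin n} (hkl : k ≠ l) (h : ¬ (k = i ∧ l = j)) :
    (transvectionGL hij.symm (-a⁻¹) * transvectionGL hij a *
      permGL n F (Equiv.swap i j) : GL (Fin n) F).1 k l = 0 := by
  have hX : ∀ k l, Matrix.transvection i j a k l =
      (if k = l then 1 else 0) + if i = k ∧ j = l then a else 0 :=
    fun k l => transvectionGL_apply hij a k l
  have := permGL_inv_mul_mul_permGL_apply 1 (Equiv.swap i j)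
    (transvectionGL hij.symm (-a⁻¹) * transvectionGL hij a) k l
  rw [map_one, inv_one, one_mul] at this
  rw [this, Units.val_mul, coe_transvectionGL, coe_transvectionGL, Equiv.Perm.one_apply]
  have hs := Equiv.swap_apply_def i j l
  by_cases hk : k = j
  · subst hk
    rw [Matrix.transvection_mul_apply_same, hX, hX]
    by_cases hl : l = i
    · subst hl
      simp [hij, ha]
    · rw [Equiv.swap_apply_of_ne_of_ne hl (Ne.symm hkl)]
      simp [hkl, Ne.symm hl]
  · rw [Matrix.transvection_mul_apply_of_ne _ _ _ _ hk, hX]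
    grind

theorem swap_mul_transvectionGL_mul_swap_cosetSum {i j : Fin n} (hij : i ≠ j) {a : F}
    (ha : a ≠ 0) (σ : Equiv.Perm (Fin n)) (hσ : σ⁻¹ i < σ⁻¹ j) :
    cosetSum R (permGL n F (Equiv.swap i j) * transvectionGL hij a *
      permGL n F (Equiv.swap i j * σ)) =
    cosetSum R (transvectionGL hij a⁻¹ * permGL n F (Equiv.swap i j * σ)) := by
  refine cosetSum_eq fun k l hkl => ?_
  have hkl : l < k := hkl
  have hconj : (permGL n F (Equiv.swap i j))⁻¹ * transvectionGL hij (-a⁻¹) *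
      permGL n F (Equiv.swap i j) = transvectionGL hij.symm (-a⁻¹) := by
    have := permGL_inv_mul_transvectionGL_mul_permGL (Equiv.swap i j) hij.symm (-a⁻¹)
    simpa only [Equiv.swap_apply_left, Equiv.swap_apply_right] using this
  have : (transvectionGL hij a⁻¹ * permGL n F (Equiv.swap i j * σ))⁻¹ *
      (permGL n F (Equiv.swap i j) * transvectionGL hij a * permGL n F (Equiv.swap i j * σ)) =
      (permGL n F σ)⁻¹ * (transvectionGL hij.symm (-a⁻¹) * transvectionGL hij a *
        permGL n F (Equiv.swap i j)) * permGL n F σ := by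
    rw [← hconj, ← transvectionGL_inv, map_mul]; group
  rw [this, permGL_inv_mul_mul_permGL_apply]
  refine transvectionGL_mul_transvectionGL_mul_swap_apply hij ha (σ.injective.ne hkl.ne') ?_
  rintro ⟨rfl, rfl⟩
  simp only [Equiv.Perm.inv_def, Equiv.symm_apply_apply] at hσ
  exact absurd hσ hkl.asymm

/-- The terms for `σ` and `s σ` cancel. If `σ⁻¹ i < σ⁻¹ j`, the term of `σ` reduces to `sign σ`
times the coset sum of `s σ`, and the term of `s σ` to its negative. -/
theorem swap_mul_transvectionGL_mul_steinbergElement {i j : Fin n} (hij : i ≠ j) {a : F}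
    (ha : a ≠ 0) :
    single (permGL n F (Equiv.swap i j) * transvectionGL hij a) (1 : R) *
        steinbergElement n F R =
      single (transvectionGL hij a⁻¹) (1 : R) * steinbergElement n F R -
        steinbergElement n F R := by
  rw [← sub_eq_zero, sub_sub_eq_add_sub, sub_eq_zero, ← sub_eq_zero,
    single_mul_steinbergElement, single_mul_steinbergElement, steinbergElement_eq_sum,
    ← Finset.sum_add_distrib, ← Finset.sum_sub_distrib]
  set s := Equiv.swap i j with hs
  set f : Equiv.Perm (Fin n) → R[GL (Fin n) F] := fun σ =>
    (((Equiv.Perm.sign σ : ℤˣ) : ℤ) : R) •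
      cosetSum R (permGL n F s * transvectionGL hij a * permGL n F σ) +
    (((Equiv.Perm.sign σ : ℤˣ) : ℤ) : R) • cosetSum R (permGL n F σ) -
    (((Equiv.Perm.sign σ : ℤˣ) : ℤ) : R) • cosetSum R (transvectionGL hij a⁻¹ * permGL n F σ)
    with hf
  have hss : ∀ σ, s * (s * σ) = σ := fun σ => by rw [← mul_assoc, hs, Equiv.swap_mul_self, one_mul]
  have key : ∀ σ : Equiv.Perm (Fin n), σ⁻¹ i < σ⁻¹ j → f σ + f (s * σ) = 0 := by
    intro σ hσ
    have h1 := transvectionGL_mul_cosetSum (R := R) hij a σ hσ (permGL n F s)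
    have h2 := transvectionGL_mul_cosetSum (R := R) hij a⁻¹ σ hσ 1
    have h3 := swap_mul_transvectionGL_mul_swap_cosetSum (R := R) hij ha σ hσ
    rw [one_mul, one_mul] at h2
    have hsign : Equiv.Perm.sign (s * σ) = - Equiv.Perm.sign σ := by
      rw [Equiv.Perm.sign_mul, hs, Equiv.Perm.sign_swap hij, neg_one_mul]
    simp only [hf]
    rw [h1, h2, h3, hsign, map_mul, ← hs]
    simp
  refine Finset.sum_involution (fun σ _ => s * σ) (fun σ _ => ?_) (fun σ _ _ h => ?_)
    (fun _ _ => Finset.mem_univ _) (fun σ _ => hss σ)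
  · rcases lt_or_gt_of_ne (σ⁻¹.injective.ne hij) with h | h
    · exact key σ h
    · have := key (s * σ) (by simpa [hs] using h)
      rwa [hss, add_comm] at this
  · rw [mul_eq_right, hs, Equiv.swap_eq_one_iff] at h
    exact hij h

end GroupAlgebra

/-! ### The unitriangular translates of the Steinberg element as a basis of the lattice. -/

section Spanning

open MonoidAlgebra

theorem perm_submonoid_eq_top {n : ℕ} (S : Submonoid (Equiv.Perm (Fin n)))
    (hS : ∀ i j : Fin n, (j : ℕ) = i + 1 → Equiv.swap i j ∈ S) : S = ⊤ := by
  rcases n with _ | n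
  · exact eq_top_iff.2 fun σ _ => by rw [Subsingleton.elim σ 1]; exact S.one_mem
  · rw [eq_top_iff, ← Equiv.Perm.mclosure_swap_castSucc_succ, Submonoid.closure_le]
    rintro _ ⟨i, rfl⟩
    exact hS _ _ (by simp)

/-- An invertible matrix is a product of diagonal matrices and transvections, and a lower
transvection is conjugate to an upper one by a transposition. -/
theorem submonoid_eq_top {n : ℕ} {F : Type*} [Field F] (S : Submonoid (GL (Fin n) F))
    (hB : ∀ b ∈ borelSubgroup n F, b ∈ S)
    (hS : ∀ i j : Fin n, (j : ℕ) = i + 1 → permGL n F (Equiv.swap i j) ∈ S) : S = ⊤ := by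
  have hperm : ∀ σ, permGL n F σ ∈ S := fun σ => by
    have := perm_submonoid_eq_top (S.comap (permGL n F)) hS
    exact (this ▸ Submonoid.mem_top σ : σ ∈ S.comap (permGL n F))
  refine eq_top_iff.2 fun g _ => ?_
  have key := Matrix.diagonal_transvection_induction_of_det_ne_zero
    (fun M : Matrix (Fin n) (Fin n) F => ∀ g : GL (Fin n) F, g.1 = M → g ∈ S) g.1
    (Matrix.GeneralLinearGroup.det_ne_zero g) ?_ ?_ ?_
  · exact key g rfl
  · intro D _ g hg
    refine hB g fun i j hij => ?_
    have hij : j < i := hij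
    rw [hg]
    exact Matrix.diagonal_apply_ne _ hij.ne'
  · rintro ⟨i, j, hij, a⟩ g hg
    obtain rfl : g = transvectionGL hij a := Units.ext hg
    rcases lt_or_gt_of_ne hij with h | h
    · exact hB _ (transvectionGL_mem_unipotentSubgroup h a).1
    · have := permGL_inv_mul_transvectionGL_mul_permGL (Equiv.swap i j) hij a
      rw [← this, ← map_inv]
      refine S.mul_mem (S.mul_mem (hperm _) (hB _ ?_)) (hperm _)
      have h' : Equiv.swap i j i < Equiv.swap i j j := by simpa using h
      exact (transvectionGL_mem_unipotentSubgroup h' a).1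
  · intro A B hA hB' h1 h2 g hg
    have : g = Matrix.GeneralLinearGroup.mkOfDetNeZero A hA *
        Matrix.GeneralLinearGroup.mkOfDetNeZero B hB' := Units.ext hg
    rw [this]
    exact S.mul_mem (h1 _ rfl) (h2 _ rfl)

variable {n : ℕ} {F : Type*} [Field F]

/-- As `i` and `j` are adjacent, `(i, j)` is the only position above the diagonal that the swap
carries below it. -/
theorem swap_conj_mem_unipotentSubgroup {i j : Fin n} (hij : (j : ℕ) = i + 1)
    {u : GL (Fin n) F} (hu : u ∈ unipotentSubgroup n F) (h0 : u.1 i j = 0) :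
    permGL n F (Equiv.swap i j) * u * (permGL n F (Equiv.swap i j))⁻¹ ∈
      unipotentSubgroup n F := by
  have hinv : (permGL n F (Equiv.swap i j))⁻¹ = permGL n F (Equiv.swap i j) := by
    rw [← map_inv, Equiv.swap_inv]
  have hconj : permGL n F (Equiv.swap i j) * u * (permGL n F (Equiv.swap i j))⁻¹ =
      (permGL n F (Equiv.swap i j))⁻¹ * u * permGL n F (Equiv.swap i j) := by rw [hinv]
  rw [hconj]
  refine ⟨fun k l hkl => ?_, fun k => ?_⟩
  · have hkl : l < k := hkl
    rw [permGL_inv_mul_mul_permGL_apply]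
    by_cases h : k = j ∧ l = i
    · rw [h.1, h.2, Equiv.swap_apply_right, Equiv.swap_apply_left, h0]
    · refine hu.1 (?_ : Equiv.swap i j l < Equiv.swap i j k)
      rw [Equiv.swap_apply_def, Equiv.swap_apply_def]
      split_ifs <;> simp only [Fin.lt_def, Fin.ext_iff] at * <;> omega
  · rw [permGL_inv_mul_mul_permGL_apply, hu.2]

variable [Fintype F] {R : Type*} [CommRing R]

variable (n F R) in
/-- The `R`-span of the elements `u e`, for `u` upper unitriangular. -/
def unipotentSpan : Submodule R R[GL (Fin n) F] :=
  Submodule.span R (Set.range fun u : unipotentSubgroup n F =>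
    single u.1 (1 : R) * steinbergElement n F R)

theorem single_mul_mem_unipotentSpan {u : GL (Fin n) F} (hu : u ∈ unipotentSubgroup n F) :
    single u (1 : R) * steinbergElement n F R ∈ unipotentSpan n F R :=
  Submodule.subset_span ⟨⟨u, hu⟩, rfl⟩

theorem swap_mul_mem_unipotentSpan {i j : Fin n} (hij : (j : ℕ) = i + 1)
    {u : GL (Fin n) F} (hu : u ∈ unipotentSubgroup n F) :
    single (permGL n F (Equiv.swap i j) * u) (1 : R) * steinbergElement n F R ∈
      unipotentSpan n F R := by
  have hlt : i < j := Fin.lt_def.2 (by omega)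
  set a := u.1 i j with ha
  set s := permGL n F (Equiv.swap i j) with hs
  -- Splitting off the `(i, j)` entry, `u = v x(a)`: the swap conjugates `v` into `U`, and the
  -- relation for `s x(a) e` handles the other factor.
  set v := u * transvectionGL hlt.ne (-a) with hv
  have hvU : v ∈ unipotentSubgroup n F :=
    mul_mem hu (transvectionGL_mem_unipotentSubgroup hlt _)
  have hv0 : v.1 i j = 0 := by
    rw [hv, Units.val_mul, coe_transvectionGL, Matrix.mul_transvection_apply_same, hu.2, ← ha]
    ring
  have huv : u = v * transvectionGL hlt.ne a := by
    rw [hv, mul_assoc, transvectionGL_mul, neg_add_cancel, transvectionGL_zero, mul_one]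
  have hw := swap_conj_mem_unipotentSubgroup hij hvU hv0
  set w := s * v * s⁻¹ with hw'
  have hsu : s * u = w * (s * transvectionGL hlt.ne a) := by rw [hw', huv]; group
  rw [hsu, ← single_mul_single_mul]
  by_cases h0 : a = 0
  · rw [h0, transvectionGL_zero, mul_one, permGL_mul_steinbergElement, mul_smul_comm]
    exact Submodule.smul_mem _ _ (single_mul_mem_unipotentSpan hw)
  · rw [swap_mul_transvectionGL_mul_steinbergElement hlt.ne h0, mul_sub, single_mul_single_mul]
    exact sub_mem (single_mul_mem_unipotentSpan
      (mul_mem hw (transvectionGL_mem_unipotentSubgroup hlt _))) (single_mul_mem_unipotentSpan hw)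

theorem single_mul_mem_of_mem_unipotentSpan (g : GL (Fin n) F) {x : R[GL (Fin n) F]}
    (hx : x ∈ unipotentSpan n F R) : single g (1 : R) * x ∈ unipotentSpan n F R := by
  let S : Submonoid (GL (Fin n) F) :=
    { carrier := {g | ∀ x ∈ unipotentSpan n F R, single g (1 : R) * x ∈ unipotentSpan n F R}
      one_mem' := fun x hx => by rwa [← one_def, one_mul]
      mul_mem' := fun {a b} ha hb x hx => by
        rw [← single_mul_single_mul]
        exact ha _ (hb _ hx) }
  -- Stability under `g` need only be tested on the generators `u e`.
  have hgen : ∀ g : GL (Fin n) F, (∀ u ∈ unipotentSubgroup n F,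
      single (g * u) (1 : R) * steinbergElement n F R ∈ unipotentSpan n F R) → g ∈ S := by
    intro g hg x hx
    refine Submodule.span_induction (p := fun x _ => single g (1 : R) * x ∈ unipotentSpan n F R)
      ?_ (by simp) (fun x y _ _ hx hy => by rw [mul_add]; exact add_mem hx hy)
      (fun r x _ hx => by rw [mul_smul_comm]; exact Submodule.smul_mem _ _ hx) hx
    rintro _ ⟨u, rfl⟩
    change single g (1 : R) * (single u.1 (1 : R) * steinbergElement n F R) ∈ _
    rw [single_mul_single_mul]
    exact hg _ u.2
  have hS : S = ⊤ := by
    refine submonoid_eq_top S (fun b hb => hgen b fun u hu => ?_)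
      (fun i j hij => hgen _ fun u hu => swap_mul_mem_unipotentSpan hij hu)
    obtain ⟨v, hv, h⟩ := borel_mul_steinbergElement (R := R) (mul_mem hb hu.1)
    rw [h]
    exact single_mul_mem_unipotentSpan hv
  exact (hS ▸ Submonoid.mem_top g : g ∈ S) x hx

theorem mem_lattice_iff {x : R[GL (Fin n) F]} :
    x ∈ lattice n F R ↔ x ∈ unipotentSpan n F R := by
  constructor
  · intro hx
    obtain ⟨z, rfl⟩ := Submodule.mem_span_singleton.1 hx
    rw [smul_eq_mul]
    induction z using MonoidAlgebra.induction_linear with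
    | zero => simp
    | add f g hf hg =>
      rw [add_mul]
      exact add_mem (hf (Submodule.mem_span_singleton.2 ⟨f, rfl⟩))
        (hg (Submodule.mem_span_singleton.2 ⟨g, rfl⟩))
    | single g r =>
      have : single g r * steinbergElement n F R =
          r • (single g (1 : R) * steinbergElement n F R) := by
        rw [← smul_mul_assoc, smul_single, smul_eq_mul, mul_one]
      rw [this]
      refine Submodule.smul_mem _ _ (single_mul_mem_of_mem_unipotentSpan g ?_)
      have h := single_mul_mem_unipotentSpan (R := R) (unipotentSubgroup n F).one_mem
      rwa [← one_def, one_mul] at h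
  · intro hx
    refine Submodule.span_induction (p := fun x _ => x ∈ lattice n F R)
      ?_ (zero_mem _) (fun x y _ _ hx hy => add_mem hx hy)
      (fun r x _ hx => ?_) hx
    · rintro _ ⟨u, rfl⟩
      exact Submodule.mem_span_singleton.2 ⟨single u.1 1, rfl⟩
    · rw [← one_mul x, ← smul_mul_assoc]
      exact Submodule.smul_mem _ (r • (1 : R[GL (Fin n) F])) hx

/-- The coset `v w₀ B`, with `w₀` the order-reversing permutation, meets the support of `u e` only
for `u = v`. So these coefficients read off the coordinates of a combination of the `u e`, over any
base ring. -/
theorem coeff_unipotent_mul_steinbergElement {u v : GL (Fin n) F}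
    (hu : u ∈ unipotentSubgroup n F) (hv : v ∈ unipotentSubgroup n F) [Decidable (u = v)] :
    (single u (1 : R) * steinbergElement n F R).coeff (v * permGL n F Fin.revPerm) =
      if u = v then (((Equiv.Perm.sign (Fin.revPerm : Equiv.Perm (Fin n)) : ℤˣ) : ℤ) : R)
      else 0 := by
  have key : ∀ σ : Equiv.Perm (Fin n),
      (u * permGL n F σ)⁻¹ * (v * permGL n F Fin.revPerm) ∈ borelSubgroup n F →
      σ = Fin.revPerm ∧ u = v := by
    intro σ h
    have hw : u⁻¹ * v ∈ unipotentSubgroup n F := mul_mem (inv_mem hu) hv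
    have heq : (u * permGL n F σ)⁻¹ * (v * permGL n F Fin.revPerm) =
      (permGL n F σ)⁻¹ * (u⁻¹ * v) * permGL n F Fin.revPerm := by group
    rw [heq] at h
    set w := u⁻¹ * v with hwdef
    have hσ : σ = Fin.revPerm := perm_eq_of_forall_le fun i => by
      by_contra hlt
      have := diag_ne_zero h i
      rw [permGL_inv_mul_mul_permGL_apply] at this
      exact this (hw.1 (not_le.1 hlt))
    refine ⟨hσ, ?_⟩
    subst hσ
    -- Conjugation by `w₀` makes `w` lower triangular, while `h` makes the result upper triangular.
    have : w = 1 := by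
      ext k l
      rcases lt_trichotomy k l with hkl | rfl | hkl
      · have := @h (Fin.rev k) (Fin.rev l) (Fin.rev_lt_rev.2 hkl)
        rw [permGL_inv_mul_mul_permGL_apply] at this
        simp only [Fin.revPerm_apply, Fin.rev_rev] at this
        simpa [hkl.ne] using this
      · simpa using hw.2 k
      · simpa [hkl.ne'] using hw.1 hkl
    exact inv_mul_eq_one.1 this
  rw [single_mul_steinbergElement, coeff_sum, Finsupp.finsetSum_apply]
  simp only [coeff_smul_apply, coeff_cosetSum]
  split_ifs with huv
  · subst huv
    rw [Finset.sum_eq_single Fin.revPerm]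
    · rw [if_pos (by rw [inv_mul_cancel]; exact one_mem _), smul_eq_mul, mul_one]
    · intro σ _ hσ
      rw [if_neg fun h => hσ (key σ h).1, smul_zero]
    · simp
  · exact Finset.sum_eq_zero fun σ _ => by rw [if_neg fun h => huv (key σ h).2, smul_zero]

/-- Lattice elements are combinations of indicators of cosets `gB`, that is, functions on `G / B`.
-/
theorem coeff_mul_of_mem_borelSubgroup {x : R[GL (Fin n) F]} (hx : x ∈ lattice n F R)
    (g : GL (Fin n) F) {b : GL (Fin n) F} (hb : b ∈ borelSubgroup n F) :
    x.coeff (g * b) = x.coeff g := by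
  classical
  refine Submodule.span_induction (p := fun x _ => x.coeff (g * b) = x.coeff g)
      ?_ rfl (fun x y _ _ hx hy => ?_) (fun r x _ hx => ?_) (mem_lattice_iff.1 hx)
  · rintro _ ⟨u, rfl⟩
    simp only [single_mul_steinbergElement, coeff_sum, Finsupp.finsetSum_apply, coeff_smul_apply,
      coeff_cosetSum, ← mul_assoc, Subgroup.mul_mem_cancel_right _ hb]
  · simp [hx, hy]
  · simp [hx]

end Spanning

/-! ### The invariant bilinear form on functions on the flag variety. -/

section Form

open MonoidAlgebra

variable {n : ℕ} {F : Type*} [Field F]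

/-- The upper triangular matrix all of whose entries on and above the diagonal are `1`. -/
def upperOnesGL (n : ℕ) (F : Type*) [Field F] : GL (Fin n) F :=
  Matrix.GeneralLinearGroup.mkOfDetNeZero (Matrix.of fun i j : Fin n => if i ≤ j then 1 else 0)
    (by
      rw [Matrix.det_of_isUpperTriangular fun i j (hij : j < i) => by simp [hij.not_ge]]
      simp)

theorem upperOnesGL_apply (i j : Fin n) :
    (upperOnesGL n F).1 i j = if i ≤ j then 1 else 0 := rfl

/-- Nonzero diagonal entries give `τ i ≤ σ i`, hence `τ = σ`. All entries of the matrix on and above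
the diagonal are nonzero, so the zeros required below the diagonal force `τ` to be increasing. -/
theorem eq_one_of_permGL_inv_mul_upperOnesGL_mul_permGL_mem {σ τ : Equiv.Perm (Fin n)}
    (h : (permGL n F τ)⁻¹ * upperOnesGL n F * permGL n F σ ∈ borelSubgroup n F) :
    τ = 1 ∧ σ = 1 := by
  have hle : τ = σ := perm_eq_of_forall_le fun i => by
    have := diag_ne_zero h i
    rw [permGL_inv_mul_mul_permGL_apply, upperOnesGL_apply] at this
    by_contra hlt
    exact this (if_neg hlt)
  subst hle
  have hmono : StrictMono τ := fun j i hji => by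
    have := h hji
    rw [permGL_inv_mul_mul_permGL_apply, upperOnesGL_apply] at this
    by_contra hlt
    rw [if_pos (not_lt.1 hlt)] at this
    exact one_ne_zero this
  have : 1 = τ := perm_eq_of_forall_le fun i => hmono.le_apply
  exact ⟨this.symm, this.symm⟩

variable [Fintype F] {K : Type*} [Field K]

instance : Fintype (GL (Fin n) F ⧸ borelSubgroup n F) := Fintype.ofFinite _

/-- The standard symmetric bilinear form for functions on `G / B`, evaluated on elements of
the group algebra. -/
def flagForm (x y : K[GL (Fin n) F]) : K :=
  ∑ q : GL (Fin n) F ⧸ borelSubgroup n F, x.coeff q.out * y.coeff q.out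

/-- On the lattice the choice of coset representatives in `flagForm` is immaterial, which is what
makes the form `G`-invariant there. -/
theorem coeff_out {x : K[GL (Fin n) F]} (hx : x ∈ lattice n F K) (g : GL (Fin n) F) :
    x.coeff (QuotientGroup.mk (s := borelSubgroup n F) g).out = x.coeff g := by
  obtain ⟨b, hb⟩ := QuotientGroup.mk_out_eq_mul (borelSubgroup n F) g
  rw [hb, coeff_mul_of_mem_borelSubgroup hx g b.2]

theorem single_mul_mem_lattice {x : K[GL (Fin n) F]} (hx : x ∈ lattice n F K)
    (g : GL (Fin n) F) : single g (1 : K) * x ∈ lattice n F K :=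
  Submodule.smul_mem _ (single g (1 : K)) hx

theorem flagForm_single_mul {x y : K[GL (Fin n) F]} (hx : x ∈ lattice n F K)
    (hy : y ∈ lattice n F K) (g : GL (Fin n) F) :
    flagForm (single g 1 * x) (single g 1 * y) = flagForm x y := by
  refine Fintype.sum_equiv (MulAction.toPerm g⁻¹) _ _ fun q => ?_
  obtain ⟨h, rfl⟩ := QuotientGroup.mk_surjective q
  have : MulAction.toPerm g⁻¹ (QuotientGroup.mk (s := borelSubgroup n F) h) =
    QuotientGroup.mk (g⁻¹ * h) := rfl
  rw [this, coeff_out hx, coeff_out hy, coeff_out (single_mul_mem_lattice hx g),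
    coeff_out (single_mul_mem_lattice hy g)]
  simp

theorem flagForm_cosetSum {x : K[GL (Fin n) F]} (hx : x ∈ lattice n F K) (g : GL (Fin n) F) :
    flagForm x (cosetSum K g) = x.coeff g := by
  classical
  rw [flagForm, Finset.sum_eq_single (QuotientGroup.mk g)]
  · rw [coeff_out hx, coeff_cosetSum, if_pos, mul_one]
    exact QuotientGroup.eq.1 (Quotient.out_eq _).symm
  · intro q _ hq
    rw [coeff_cosetSum, if_neg, mul_zero]
    intro h
    exact hq ((Quotient.out_eq q).symm.trans (QuotientGroup.eq.2 h).symm)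
  · simp

/-- In the double sum over `σ` and `τ` only `σ = τ = 1` contributes, so the form is nonzero on the
lattice in every characteristic. -/
theorem flagForm_upperOnesGL :
    flagForm (single (upperOnesGL n F)⁻¹ 1 * steinbergElement n F K) (steinbergElement n F K) =
      1 := by
  classical
  have hmem : single (upperOnesGL n F)⁻¹ 1 * steinbergElement n F K ∈ lattice n F K :=
    single_mul_mem_lattice (Submodule.mem_span_singleton_self _) _
  have key : ∀ σ τ : Equiv.Perm (Fin n),
      ((upperOnesGL n F)⁻¹ * permGL n F τ)⁻¹ * permGL n F σ ∈ borelSubgroup n F →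
      τ = 1 ∧ σ = 1 := fun σ τ h => by
    rw [mul_inv_rev, inv_inv] at h
    exact eq_one_of_permGL_inv_mul_upperOnesGL_mul_permGL_mem h
  have hone : upperOnesGL n F ∈ borelSubgroup n F := fun i j (hij : j < i) => by
    rw [upperOnesGL_apply, if_neg hij.not_ge]
  have hsum : flagForm (single (upperOnesGL n F)⁻¹ 1 * steinbergElement n F K)
      (steinbergElement n F K) = ∑ σ : Equiv.Perm (Fin n),
        (((Equiv.Perm.sign σ : ℤˣ) : ℤ) : K) *
          (single (upperOnesGL n F)⁻¹ 1 * steinbergElement n F K).coeff (permGL n F σ) := by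
    simp only [← flagForm_cosetSum hmem]
    generalize single (upperOnesGL n F)⁻¹ 1 * steinbergElement n F K = x
    simp only [steinbergElement_eq_sum, flagForm, coeff_sum, Finsupp.finsetSum_apply,
      coeff_smul_apply, smul_eq_mul, Finset.mul_sum]
    rw [Finset.sum_comm]
    exact Finset.sum_congr rfl fun _ _ => Finset.sum_congr rfl fun _ _ => mul_left_comm _ _ _
  rw [hsum, Finset.sum_eq_single 1]
  · rw [single_mul_steinbergElement, coeff_sum, Finsupp.finsetSum_apply,
      Finset.sum_eq_single 1]
    · rw [coeff_smul_apply, coeff_cosetSum, if_pos (by simpa using hone)]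
      simp
    · intro τ _ hτ
      rw [coeff_smul_apply, coeff_cosetSum, if_neg fun h => hτ (key _ _ h).1, smul_zero]
    · simp
  · intro σ _ hσ
    rw [single_mul_steinbergElement, coeff_sum, Finsupp.finsetSum_apply, Finset.sum_eq_zero,
      mul_zero]
    intro τ _
    rw [coeff_smul_apply, coeff_cosetSum, if_neg fun h => hσ (key _ _ h).2, smul_zero]
  · simp

end Form

/-! ### Representations embedded equivariantly in the lattice over a field, with the Steinberg
element in the image. -/

section Realization

open MonoidAlgebra

variable {n : ℕ} {F : Type*} [Field F] [Fintype F] {K : Type*} [Field K]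
  {V : Type*} [AddCommGroup V] [Module K V] {ρ : Representation K (GL (Fin n) F) V}
  {j : V →ₗ[K] K[GL (Fin n) F]}

instance : Fintype (unipotentSubgroup n F) := Fintype.ofFinite _

/-- The sum of the operators by which the upper unitriangular matrices act. -/
def unipotentTrace (ρ : Representation K (GL (Fin n) F) V) : V →ₗ[K] V :=
  ∑ u : unipotentSubgroup n F, ρ u.1

theorem unipotentTrace_apply (v : V) :
    unipotentTrace ρ v = ∑ u : unipotentSubgroup n F, ρ u.1 v := by
  simp [unipotentTrace]

theorem unipotentTrace_apply_apply {u : GL (Fin n) F} (hu : u ∈ unipotentSubgroup n F) (v : V) :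
    unipotentTrace ρ (ρ u v) = unipotentTrace ρ v := by
  rw [unipotentTrace_apply, unipotentTrace_apply]
  refine Fintype.sum_equiv (Equiv.mulRight ⟨u, hu⟩) _ _ fun v => ?_
  simp [← Module.End.mul_apply]

theorem span_unipotent_eq_top (hinj : Function.Injective j)
    (hj : ∀ g v, j (ρ g v) = single g 1 * j v) (hmem : ∀ v, j v ∈ lattice n F K)
    {v₀ : V} (hv₀ : j v₀ = steinbergElement n F K) :
    Submodule.span K (Set.range fun u : unipotentSubgroup n F => ρ u.1 v₀) = ⊤ := by
  refine eq_top_iff.2 fun v _ => ?_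
  have h := mem_lattice_iff.1 (hmem v)
  have hmap : unipotentSpan n F K =
      (Submodule.span K (Set.range fun u : unipotentSubgroup n F => ρ u.1 v₀)).map j := by
    rw [Submodule.map_span, ← Set.range_comp, unipotentSpan]
    congr 2
    ext1 u
    rw [Function.comp_apply, hj, hv₀]
  rw [hmap] at h
  obtain ⟨w, hw, hwv⟩ := h
  rwa [← hinj hwv]

/-- The trace takes the same value on all the spanning vectors `ρ u v₀`. -/
theorem exists_unipotentTrace_eq_smul (hinj : Function.Injective j)
    (hj : ∀ g v, j (ρ g v) = single g 1 * j v) (hmem : ∀ v, j v ∈ lattice n F K)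
    {v₀ : V} (hv₀ : j v₀ = steinbergElement n F K) (v : V) :
    ∃ c : K, unipotentTrace ρ v = c • unipotentTrace ρ v₀ := by
  have hv : v ∈ Submodule.span K (Set.range fun u : unipotentSubgroup n F => ρ u.1 v₀) := by
    rw [span_unipotent_eq_top hinj hj hmem hv₀]; trivial
  induction hv using Submodule.span_induction with
  | mem x hx =>
    obtain ⟨u, rfl⟩ := hx
    exact ⟨1, by rw [one_smul, unipotentTrace_apply_apply u.2]⟩
  | zero => exact ⟨0, by simp⟩
  | add x y _ _ hx hy =>
    obtain ⟨a, ha⟩ := hx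
    obtain ⟨b, hb⟩ := hy
    exact ⟨a + b, by rw [map_add, ha, hb, add_smul]⟩
  | smul r x _ hx =>
    obtain ⟨a, ha⟩ := hx
    exact ⟨r * a, by rw [map_smul, ha, mul_smul]⟩

/-- Choose `g` with `(j v).coeff g ≠ 0`. By right `B`-invariance each `u` contributes that same
coefficient at `1` to the trace of `ρ g⁻¹ v`, for a total of `|U|` times it. -/
theorem exists_unipotentTrace_apply_ne_zero (hU : (Nat.card (unipotentSubgroup n F) : K) ≠ 0)
    (hinj : Function.Injective j) (hj : ∀ g v, j (ρ g v) = single g 1 * j v)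
    (hmem : ∀ v, j v ∈ lattice n F K) {v : V} (hv : v ≠ 0) :
    ∃ g, unipotentTrace ρ (ρ g v) ≠ 0 := by
  have hjv : (j v).coeff ≠ 0 := fun h =>
    hv (hinj (by rw [map_zero]; exact coeff_eq_zero.1 h))
  obtain ⟨g, hg⟩ := Finsupp.ne_iff.1 hjv
  refine ⟨g⁻¹, fun h => ?_⟩
  have h1 : (j (unipotentTrace ρ (ρ g⁻¹ v))).coeff 1 =
      (Nat.card (unipotentSubgroup n F) : K) * (j v).coeff g := by
    rw [unipotentTrace_apply, map_sum, coeff_sum, Finsupp.finsetSum_apply]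
    have : ∀ u : unipotentSubgroup n F, (j (ρ u.1 (ρ g⁻¹ v))).coeff 1 = (j v).coeff g :=
      fun u => by
        rw [hj, hj, single_mul_single_mul, coeff_single_mul_apply, one_mul, mul_inv_rev, inv_inv,
          mul_one, coeff_mul_of_mem_borelSubgroup (hmem v) g (inv_mem u.2).1]
    simp [this]
  rw [h, map_zero] at h1
  exact mul_ne_zero hU hg h1.symm

/-- Every nonzero subrepresentation contains the vector fixed by the unitriangular matrices. -/
theorem unipotentTrace_mem (hU : (Nat.card (unipotentSubgroup n F) : K) ≠ 0)
    (hinj : Function.Injective j) (hj : ∀ g v, j (ρ g v) = single g 1 * j v)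
    (hmem : ∀ v, j v ∈ lattice n F K) {v₀ : V} (hv₀ : j v₀ = steinbergElement n F K)
    (W : Submodule K V) (hW : ∀ g, ∀ v ∈ W, ρ g v ∈ W) {v : V} (hvW : v ∈ W) (hv : v ≠ 0) :
    unipotentTrace ρ v₀ ∈ W := by
  obtain ⟨g, hg⟩ := exists_unipotentTrace_apply_ne_zero hU hinj hj hmem hv
  obtain ⟨c, hc⟩ := exists_unipotentTrace_eq_smul hinj hj hmem hv₀ (ρ g v)
  have hc0 : c ≠ 0 := by
    rintro rfl
    exact hg (by rw [hc, zero_smul])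
  have hmemW : unipotentTrace ρ (ρ g v) ∈ W := by
    rw [unipotentTrace_apply]
    exact Submodule.sum_mem _ fun u _ => hW _ _ (hW _ _ hvW)
  rw [hc] at hmemW
  exact (Submodule.smul_mem_iff _ hc0).1 hmemW

theorem unipotentTrace_ne_zero (hU : (Nat.card (unipotentSubgroup n F) : K) ≠ 0)
    (hinj : Function.Injective j) (hj : ∀ g v, j (ρ g v) = single g 1 * j v)
    (hmem : ∀ v, j v ∈ lattice n F K) {v₀ : V} (hv₀ : j v₀ = steinbergElement n F K)
    (hne : v₀ ≠ 0) : unipotentTrace ρ v₀ ≠ 0 := by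
  obtain ⟨g, hg⟩ := exists_unipotentTrace_apply_ne_zero hU hinj hj hmem hne
  obtain ⟨c, hc⟩ := exists_unipotentTrace_eq_smul hinj hj hmem hv₀ (ρ g v₀)
  intro h
  exact hg (by rw [hc, h, smul_zero])

theorem steinbergElement_ne_zero : steinbergElement n F K ≠ 0 := by
  classical
  intro h
  have h1 := flagForm_upperOnesGL (n := n) (F := F) (K := K)
  rw [h] at h1
  simp [flagForm] at h1

theorem isIrreducible_of_isSelfDual (hU : (Nat.card (unipotentSubgroup n F) : K) ≠ 0)
    (hinj : Function.Injective j) (hj : ∀ g v, j (ρ g v) = single g 1 * j v)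
    (hmem : ∀ v, j v ∈ lattice n F K) {v₀ : V} (hv₀ : j v₀ = steinbergElement n F K)
    (hdual : IsSelfDual ρ) : ρ.IsIrreducible := by
  obtain ⟨φ⟩ := hdual
  have hne : v₀ ≠ 0 := by
    rintro rfl
    exact steinbergElement_ne_zero (by rw [← hv₀, map_zero])
  have hφ : ∀ g v w, φ (ρ g v) w = φ v (ρ g⁻¹ w) := fun g v w => by
    have := LinearMap.congr_fun (φ.toIntertwiningMap.isIntertwining' g) v
    exact LinearMap.congr_fun this w
  have hφinj : ∀ v, φ v = 0 → v = 0 := fun v hv => by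
    have : φ.toLinearEquiv v = 0 := hv
    exact (LinearEquiv.map_eq_zero_iff _).1 this
  set y := unipotentTrace ρ v₀ with hy
  have hy0 : y ≠ 0 := unipotentTrace_ne_zero hU hinj hj hmem hv₀ hne
  have hyu : ∀ u ∈ unipotentSubgroup n F, ∀ w, φ y (ρ u w) = φ y w := by
    intro u hu w
    have hfix : ρ u⁻¹ y = y := by
      rw [hy, unipotentTrace_apply, map_sum]
      refine Fintype.sum_equiv (Equiv.mulLeft (⟨u, hu⟩ : unipotentSubgroup n F)⁻¹) _ _ fun v => ?_
      simp [← Module.End.mul_apply]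
    have := hφ u⁻¹ y w
    rw [hfix, inv_inv] at this
    exact this.symm
  -- By `U`-invariance `φ y y = |U| φ y v₀`; were it zero, `φ y` would vanish on every `ρ u v₀`, and
  -- these span.
  have hyy : φ y y ≠ 0 := by
    intro h
    have h1 : φ y y = (Nat.card (unipotentSubgroup n F) : K) * φ y v₀ := by
      have h3 : y = ∑ u : unipotentSubgroup n F, ρ u.1 v₀ := unipotentTrace_apply v₀
      calc φ y y = ∑ u : unipotentSubgroup n F, φ y (ρ u.1 v₀) := by rw [← map_sum, ← h3]
        _ = _ := by simp [hyu _ (Subtype.property _)]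
    have h2 : φ y v₀ = 0 := by
      rw [h] at h1
      exact (mul_eq_zero.1 h1.symm).resolve_left hU
    refine hy0 (hφinj y (LinearMap.ext_on_range
      (span_unipotent_eq_top hinj hj hmem hv₀) fun u => ?_))
    rw [hyu _ u.2, h2, LinearMap.zero_apply]
  have hnt : Nontrivial (Subrepresentation ρ) := by
    refine ⟨⊥, ⊤, fun h => hne ?_⟩
    have : v₀ ∈ (⊤ : Subrepresentation ρ).toSubmodule := Submodule.mem_top
    rw [← h] at this
    exact this
  refine ⟨fun W => ?_⟩
  by_contra hcon
  rw [not_or] at hcon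
  have hbot : W.toSubmodule ≠ ⊥ := fun h => hcon.1 (Subrepresentation.toSubmodule_injective h)
  have htop : W.toSubmodule ≠ ⊤ := fun h => hcon.2 (Subrepresentation.toSubmodule_injective h)
  obtain ⟨w, hwW, hw⟩ := Submodule.exists_mem_ne_zero_of_ne_bot hbot
  have hyW := unipotentTrace_mem hU hinj hj hmem hv₀ W.toSubmodule
    (fun g v hv => W.apply_mem_toSubmodule g hv) hwW hw
  obtain ⟨f, hf0, hfW⟩ := Submodule.exists_le_ker_of_lt_top _ (lt_top_iff_ne_top.2 htop)
  -- `P` is a subrepresentation, nonzero since it contains the preimage `x` of a nonzero functional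
  -- `f` killing `W`. Hence `y ∈ P`, while also `y ∈ W`.
  let P : Submodule K V := W.toSubmodule.dualAnnihilator.comap φ.toLinearMap
  have hP : ∀ v, v ∈ P ↔ ∀ w ∈ W.toSubmodule, φ v w = 0 := fun v =>
    Submodule.mem_dualAnnihilator _
  obtain ⟨x, hx⟩ := φ.toLinearEquiv.surjective f
  have hx' : φ x = f := hx
  have hyP : y ∈ P := by
    refine unipotentTrace_mem hU hinj hj hmem hv₀ P (fun g v hv => ?_) (v := x) ?_ ?_
    · rw [hP] at hv ⊢
      intro w hw
      rw [hφ]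
      exact hv _ (W.apply_mem_toSubmodule _ hw)
    · rw [hP]
      intro w hw
      rw [hx']
      exact hfW hw
    · rintro rfl
      exact hf0 (by rw [← hx', map_zero])
  exact hyy ((hP y).1 hyP y hyW)

theorem isSelfDual_of_isIrreducible
    (hinj : Function.Injective j) (hj : ∀ g v, j (ρ g v) = single g 1 * j v)
    (hmem : ∀ v, j v ∈ lattice n F K) {v₀ : V} (hv₀ : j v₀ = steinbergElement n F K)
    (hirr : ρ.IsIrreducible) : IsSelfDual ρ := by
  have : Module.Finite K K[GL (Fin n) F] := Module.Finite.equiv (coeffLinearEquiv K).symm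
  have : Module.Finite K V := Module.Finite.of_injective j hinj
  let β : V →ₗ[K] V →ₗ[K] K := LinearMap.mk₂ K (fun v w => flagForm (j v) (j w))
    (fun a b c => by simp [flagForm, add_mul, Finset.sum_add_distrib])
    (fun r a b => by simp [flagForm, Finset.mul_sum, mul_assoc])
    (fun a b c => by simp [flagForm, mul_add, Finset.sum_add_distrib])
    (fun r a b => by simp [flagForm, Finset.mul_sum, mul_left_comm])
  have hβ : ∀ v w, β v w = flagForm (j v) (j w) := fun _ _ => rfl
  let f : Representation.IntertwiningMap ρ ρ.dual :=
    { toLinearMap := β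
      isIntertwining' := fun g => by
        ext v w
        change β (ρ g v) w = β v (ρ g⁻¹ w)
        rw [hβ, hβ, ← flagForm_single_mul (hmem v) (hmem _) g, hj, hj, single_mul_single_mul,
          mul_inv_cancel, ← one_def, one_mul] }
  -- By irreducibility `f` is injective or zero, and the form takes the value `1`; equality of
  -- dimensions then gives bijectivity.
  have hf : Function.Injective f := by
    refine (Representation.IsIrreducible.injective_or_eq_zero f).resolve_right fun h => ?_
    have h1 : β (ρ (upperOnesGL n F)⁻¹ v₀) v₀ = 1 := by
      rw [hβ, hj, hv₀, flagForm_upperOnesGL]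
    have h2 : β = 0 := congrArg Representation.IntertwiningMap.toLinearMap h
    rw [h2] at h1
    exact zero_ne_one h1
  exact ⟨Representation.Equiv.mk
    (LinearMap.linearEquivOfInjective β hf (Subspace.dual_finrank_eq).symm)
    (fun g => f.isIntertwining' g)⟩

end Realization

/-! ### Embedding the reduced lattice in the group algebra of the residue field. -/

section Reduction

open MonoidAlgebra IsLocalRing

variable {n : ℕ} {F : Type*} [Field F] [Fintype F] {R : Type*} [CommRing R] [IsLocalRing R]

omit [IsLocalRing R] in
theorem mapRingHom_steinbergElement {S : Type*} [CommRing S] (f : R →+* S) :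
    mapRingHom (GL (Fin n) F) f (steinbergElement n F R) = steinbergElement n F S := by
  simp [steinbergElement, map_sum]

variable (n F R) in
/-- Coefficientwise reduction of the elements of the Steinberg lattice. -/
def latticeReduction : lattice n F R →ₗ[R] (ResidueField R)[GL (Fin n) F] where
  toFun x := mapRingHom (GL (Fin n) F) (residue R) x.1
  map_add' x y := by simp
  map_smul' r x := by
    ext g
    simp [Algebra.smul_def]

theorem smul_top_le_ker_latticeReduction :
    maximalIdeal R • (⊤ : Submodule R (lattice n F R)) ≤
      LinearMap.ker (latticeReduction n F R) := by
  refine Submodule.smul_le.2 fun r hr x _ => ?_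
  rw [LinearMap.mem_ker, map_smul, ← algebraMap_smul (ResidueField R) r,
    ResidueField.algebraMap_eq, (residue_eq_zero_iff r).2 hr, zero_smul]

variable (n F R) in
/-- The embedding of the reduced Steinberg lattice into the group algebra of the residue field. -/
def reductionEmbedding :
    ModReduction R (lattice n F R) →ₗ[ResidueField R] (ResidueField R)[GL (Fin n) F] where
  toFun := Submodule.liftQ _ (latticeReduction n F R) smul_top_le_ker_latticeReduction
  map_add' x y := map_add _ x y
  map_smul' c x := by
    obtain ⟨r, rfl⟩ := residue_surjective c
    obtain ⟨v, rfl⟩ := ModReduction.mk_surjective R _ x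
    rw [ModReduction.residue_smul_mk]
    change latticeReduction n F R (r • v) = residue R r • latticeReduction n F R v
    rw [map_smul, ← algebraMap_smul (ResidueField R) r]
    rfl

theorem reductionEmbedding_mk (x : lattice n F R) :
    reductionEmbedding n F R (ModReduction.mk R _ x) =
      mapRingHom (GL (Fin n) F) (residue R) x.1 := rfl

theorem reductionEmbedding_mem (x : ModReduction R (lattice n F R)) :
    reductionEmbedding n F R x ∈ lattice n F (ResidueField R) := by
  obtain ⟨⟨v, hv⟩, rfl⟩ := ModReduction.mk_surjective R _ x
  obtain ⟨z, rfl⟩ := Submodule.mem_span_singleton.1 hv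
  rw [reductionEmbedding_mk]
  change mapRingHom (GL (Fin n) F) (residue R) (z * steinbergElement n F R) ∈ _
  rw [map_mul, mapRingHom_steinbergElement]
  exact Submodule.mem_span_singleton.2 ⟨_, rfl⟩

theorem reductionEmbedding_reducedRep (g : GL (Fin n) F) (x : ModReduction R (lattice n F R)) :
    reductionEmbedding n F R (reducedRep n F R g x) =
      single g 1 * reductionEmbedding n F R x := by
  obtain ⟨v, rfl⟩ := ModReduction.mk_surjective R _ x
  have : reducedRep n F R g (ModReduction.mk R _ v) =
    ModReduction.mk R _ (latticeRep n F R g v) := rfl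
  rw [this, reductionEmbedding_mk, reductionEmbedding_mk, coe_latticeRep_apply, map_mul]
  simp

/-- If a combination of the `u e` has all coefficients in the maximal ideal `𝔪`, its values at `u
w₀` put each coordinate `c u` in `𝔪` up to sign, so it lies in `𝔪 I`: the lattice is pure in `R[G]`.
-/
theorem reductionEmbedding_injective : Function.Injective (reductionEmbedding n F R) := by
  classical
  rw [injective_iff_map_eq_zero]
  intro x hx
  obtain ⟨v, rfl⟩ := ModReduction.mk_surjective R _ x
  rw [reductionEmbedding_mk] at hx
  obtain ⟨c, hc⟩ := (Submodule.mem_span_range_iff_exists_fun R).1 (mem_lattice_iff.1 v.2)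
  have hcoeff : ∀ u : unipotentSubgroup n F, residue R (c u) = 0 := by
    intro u
    have h1 := congrArg (fun z => z.coeff (u.1 * permGL n F Fin.revPerm)) hx
    simp only [coeff_mapRingHom, ← hc, coeff_sum, Finsupp.finsetSum_apply, coeff_smul_apply] at h1
    rw [Finset.sum_eq_single u] at h1
    · rw [coeff_unipotent_mul_steinbergElement u.2 u.2, if_pos rfl, smul_eq_mul, map_mul] at h1
      rcases Int.units_eq_one_or (Equiv.Perm.sign (Fin.revPerm : Equiv.Perm (Fin n))) with h | h <;>
        simpa [h] using h1
    · intro w _ hw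
      rw [coeff_unipotent_mul_steinbergElement w.2 u.2, if_neg fun h => hw (Subtype.ext h),
        smul_zero]
    · simp
  have hv : v = ∑ u, c u • (⟨single u.1 1 * steinbergElement n F R,
      Submodule.mem_span_singleton.2 ⟨single u.1 1, rfl⟩⟩ : lattice n F R) := by
    ext1
    rw [← hc]
    simp
  rw [hv, map_sum]
  refine Finset.sum_eq_zero fun u _ => ?_
  rw [← ModReduction.residue_smul_mk, hcoeff, zero_smul]

theorem natCard_unipotentSubgroup_ne_zero {p : ℕ} (hp : p.Prime) [CharP F p] {K : Type*} [Field K]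
    (hpK : (p : K) ≠ 0) : (Nat.card (unipotentSubgroup n F) : K) ≠ 0 := by
  have := Fact.mk hp
  obtain ⟨k, hk⟩ := IsPGroup.iff_card.1 (isPGroup_unipotentSubgroup (n := n) (F := F) p hp)
  rw [hk, Nat.cast_pow]
  exact pow_ne_zero _ hpK

theorem natCast_residueField_ne_zero {p ℓ : ℕ} (h : Nat.Coprime p ℓ)
    (hℓ : (ℓ : R) ∈ maximalIdeal R) : (p : ResidueField R) ≠ 0 := by
  intro hp
  have hℓ' : (ℓ : ResidueField R) = 0 := by
    rw [← map_natCast (residue R), residue_eq_zero_iff]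
    exact hℓ
  obtain ⟨a, b, hab⟩ := Nat.isCoprime_iff_coprime.2 h
  have := congrArg (Int.cast : ℤ → ResidueField R) hab
  simp [hp, hℓ'] at this

end Reduction

end SteinbergLattice

end

theorem theorem6p2 (n : ℕ) (hn : 2 ≤ n) (p ℓ : ℕ) (hp : p.Prime) (hℓ : ℓ.Prime) (hℓp : ℓ ≠ p)
    (F : Type*) [Field F] [Fintype F] [CharP F p]
    (R : Type*) [CommRing R] [IsDomain R] [IsPrincipalIdealRing R] [IsLocalRing R] [CharZero R]
    (hR : IsLocalRing.maximalIdeal R = Ideal.span {(ℓ : R)})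
    (hζ : ∃ ζ : R, IsPrimitiveRoot ζ p) :
    SteinbergLattice.IsSelfDual (SteinbergLattice.reducedRep n F R) ↔
      (SteinbergLattice.reducedRep n F R).IsIrreducible := by
  have hpK : (p : IsLocalRing.ResidueField R) ≠ 0 :=
    SteinbergLattice.natCast_residueField_ne_zero ((Nat.coprime_primes hp hℓ).2 hℓp.symm)
      (by rw [hR]; exact Ideal.mem_span_singleton_self _)
  have hv₀ : SteinbergLattice.reductionEmbedding n F R (SteinbergLattice.ModReduction.mk R _
      ⟨SteinbergLattice.steinbergElement n F R, Submodule.mem_span_singleton_self _⟩) =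
      SteinbergLattice.steinbergElement n F (IsLocalRing.ResidueField R) :=
    SteinbergLattice.mapRingHom_steinbergElement _
  exact ⟨SteinbergLattice.isIrreducible_of_isSelfDual
      (SteinbergLattice.natCard_unipotentSubgroup_ne_zero hp hpK)
      SteinbergLattice.reductionEmbedding_injective
      SteinbergLattice.reductionEmbedding_reducedRep
      SteinbergLattice.reductionEmbedding_mem hv₀,
    SteinbergLattice.isSelfDual_of_isIrreducible
      SteinbergLattice.reductionEmbedding_injective
      SteinbergLattice.reductionEmbedding_reducedRep
      SteinbergLattice.reductionEmbedding_mem hv₀⟩
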